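/- Let $a_1,\dots,a_6\in\mathbb{C}$ with $\Re\left(\sum_{j=1}^6 a_j\right)>-\tfrac52$. Let $$f(x):=\frac{1}{\prod_{j=1}^6\Gamma(1+a_j+x)\,\Gamma(1+a_j-x)},$$ which is an entire function of $x$ (with $1/\Gamma$ read as $0$ at the poles of $\Gamma$), and for $k\in\mathbb{Z}$ let $$S_k:=\frac16\sum_{\ell=-\infty}^{\infty} f\left(\ell+\tfrac{k}{6}\right).$$ Then $f$ is integrable over $\mathbb{R}$, the series defining $S_k$ converges absolutely for every $k\in\mathbb{Z}$, and $$\int_{-\infty}^{\infty}\frac{dx}{\prod_{j=1}^6\Gamma(1+a_j+x)\,\Gamma(1+a_j-x)}=2S_0+4S_2=2S_3+4S_1 .$$ Moreover, for every $k\in\mathbb{Z}$ such that $a_j+1+\frac k6\notin\{0,-1,-2,\dots\}$ and $-a_j+\frac k6\notin\{1,2,3,\dots\}$ for $j=1,\dots,6$, we have $$S_k=\frac{1}{6\prod_{j=1}^6\Gamma(a_j+1+\frac k6)\,\Gamma(a_j+1-\frac k6)}\;\sum_{n=-\infty}^{\infty}\ \prod_{j=1}^6\frac{(-a_j+\frac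 k6)_n}{(a_j+1+\frac k6)_n},$$ where the series on the right is absolutely convergent; it is the bilateral hypergeometric series ${}_6H_6$ with numerator parameters $-a_j+\frac k6$ and denominator parameters $a_j+1+\frac k6$ at argument $1$. Here, for $n\ge 0$, $(c)_n=c(c+1)\cdots(c+n-1)$, and, for $n\ge1$, $(c)_{-n}=\frac{1}{(c-1)(c-2)\cdots(c-n)}$ (so $(c)_n=\Gamma(c+n)/\Gamma(c)$); a term with a factor $1/(c)_{-n}$, $c\in\{1,\dots,n\}$, is $0$. -/

import Mathlib

noncomputable section

/-- The shifted factorial `(c)_n = Γ(c+n)/Γ(c)` for `n ∈ ℤ`, written as the rational function of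
`c` that this quotient is: `(c)_n = c (c+1) ⋯ (c+n-1)` for `n ≥ 0`, and
`(c)_{-n} = 1 / ((c-n) (c-n+1) ⋯ (c-1))` for `n ≥ 1`
(which is finite if and only if `c ∉ {1, …, n}`). -/
def shiftedFactorial (c : ℂ) : ℤ → ℂ
  | Int.ofNat n => (ascPochhammer ℂ n).eval c
  | Int.negSucc n => ((ascPochhammer ℂ (n + 1)).eval (c - (n + 1)))⁻¹

/-- The general term `(c_1)_n ⋯ (c_p)_n / ((d_1)_n ⋯ (d_q)_n) * z ^ n` of a bilateral
hypergeometric series. -/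
def bilateralTerm {p q : ℕ} (c : Fin p → ℂ) (d : Fin q → ℂ) (z : ℂ) (n : ℤ) : ℂ :=
  (∏ j, shiftedFactorial (c j) n) / (∏ j, shiftedFactorial (d j) n) * z ^ n

/-- The bilateral series `pHq(c_1, …, c_p; d_1, …, d_q; z)`. It is well-defined if no `c_j` is a
positive integer and no `d_j` is a non-positive integer. -/
def bilateralH {p q : ℕ} (c : Fin p → ℂ) (d : Fin q → ℂ) (z : ℂ) : ℂ :=
  ∑' n : ℤ, bilateralTerm c d z n

/-- The entire function `f(x) = 1 / ∏ j, Γ(1 + a_j + x) Γ(1 + b_j - x)`. At the poles of `Γ`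
Mathlib's `Complex.Gamma` is `0`, and the inverse of `0` is `0`, so that `f` vanishes there, as the
entire function does. -/
def recipGammaProd {m : ℕ} (a b : Fin m → ℂ) (x : ℂ) : ℂ :=
  1 / ∏ j, (Complex.Gamma (1 + a j + x) * Complex.Gamma (1 + b j - x))

/-- The general term `f(ℓ + k/p) * exp(-i (ℓ + k/p) t)` of `p * S_k(t)`. -/
def sTerm {m : ℕ} (a b : Fin m → ℂ) (p : ℕ) (k : ℤ) (t : ℝ) (l : ℤ) : ℂ :=
  recipGammaProd a b ((l : ℂ) + (k : ℂ) / (p : ℂ)) *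
    Complex.exp (-(Complex.I * ((l : ℂ) + (k : ℂ) / (p : ℂ)) * (t : ℂ)))

/-- `S_k(t) = (1/p) ∑_{ℓ ∈ ℤ} f(ℓ + k/p) exp(-i (ℓ + k/p) t)`. -/
def sSum {m : ℕ} (a b : Fin m → ℂ) (p : ℕ) (k : ℤ) (t : ℝ) : ℂ :=
  1 / (p : ℂ) * ∑' l : ℤ, sTerm a b p k t l

/-- `C_k = 1 / ∏ j, Γ(a_j + 1 + k/p) Γ(b_j + 1 - k/p)`. -/
def cCoeff {m : ℕ} (a b : Fin m → ℂ) (p : ℕ) (k : ℤ) : ℂ :=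
  1 / ∏ j, (Complex.Gamma (a j + 1 + (k : ℂ) / (p : ℂ)) *
    Complex.Gamma (b j + 1 - (k : ℂ) / (p : ℂ)))

end

/-! The integrand `f` is a product of six even entire functions `1 / (Γ(1 + a + z) Γ(1 + a - z))`.
Each has exponential type at most `π`, and on the real line it is `O((1 + |x|) ^ (-(2 Re a + 1)))`.
So `f` has type at most `6π` and decays like `|x| ^ (-(2 Re ∑ a_j + 6))`; the hypothesis says
exactly that this exponent is below `-1`, which gives all the absolute convergence.

By a Paley–Wiener argument (`fourier_eq_zero_of_exponential_type`) and continuity, the Fourier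
transform `F` of `f` vanishes for `|ξ| ≥ 3`, endpoints included. Poisson summation on `ℤ + k/6`
therefore keeps only the frequencies `-2, …, 2`, and since `F` is even, `6 S_k = F(0) + 2 cos(πk/3)
F(1) + 2 cos(2πk/3) F(2)` (`six_mul_sSum_eq`). The integral is `F(0)`, and the weights `1 : 2` on `k
= 0, 2` or on `k = 3, 1` cancel `F(1)` and `F(2)`. The hypergeometric form is a termwise rewriting
of `1/Γ` at integer shifts. -/

open Filter Topology

/-! ### Exponential type of a single factor. -/

/-- The even entire function `z ↦ 1 / (Γ(1 + a + z) Γ(1 + a - z))`. -/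
noncomputable def evenRecipGamma (a z : ℂ) : ℂ :=
  (Complex.Gamma (1 + a + z) * Complex.Gamma (1 + a - z))⁻¹

theorem differentiable_evenRecipGamma (a : ℂ) : Differentiable ℂ (evenRecipGamma a) := by
  have h := Complex.differentiable_one_div_Gamma
  have h1 : Differentiable ℂ fun z : ℂ => (Complex.Gamma (1 + a + z))⁻¹ :=
    h.comp (f := fun z : ℂ => 1 + a + z) (by fun_prop)
  have h2 : Differentiable ℂ fun z : ℂ => (Complex.Gamma (1 + a - z))⁻¹ :=
    h.comp (f := fun z : ℂ => 1 + a - z) (by fun_prop)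
  have h3 : evenRecipGamma a =
      fun z : ℂ => (Complex.Gamma (1 + a + z))⁻¹ * (Complex.Gamma (1 + a - z))⁻¹ := by
    funext z
    rw [evenRecipGamma, mul_inv]
  rw [h3]
  exact h1.mul h2

theorem evenRecipGamma_neg (a z : ℂ) : evenRecipGamma a (-z) = evenRecipGamma a z := by
  simp only [evenRecipGamma, ← sub_eq_add_neg, sub_neg_eq_add]
  rw [mul_comm]

/-- Carries bounds from `a + 1` to `a` at the cost of a quadratic factor, so that estimates need
only be proved for `0 ≤ a.re`. -/
theorem evenRecipGamma_eq_mul_add_one (a z : ℂ) :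
    evenRecipGamma a z = ((1 + a) ^ 2 - z ^ 2) * evenRecipGamma (a + 1) z := by
  simp only [evenRecipGamma, mul_inv]
  rw [Complex.one_div_Gamma_eq_self_mul_one_div_Gamma_add_one (1 + a + z),
    Complex.one_div_Gamma_eq_self_mul_one_div_Gamma_add_one (1 + a - z)]
  rw [show 1 + a + z + 1 = 1 + (a + 1) + z by ring, show 1 + a - z + 1 = 1 + (a + 1) - z by ring]
  ring

theorem norm_one_add_sq_sub_sq_le (a z : ℂ) :
    ‖(1 + a) ^ 2 - z ^ 2‖ ≤ ‖1 + a‖ ^ 2 + ‖z‖ ^ 2 :=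
  (norm_sub_le _ _).trans_eq (by rw [norm_pow, norm_pow])

/-- In Gauss's approximants of `Γ` the `z`-dependence of the powers of `n` cancels, leaving a finite
Weierstrass-type product. For `0 ≤ a.re` it is dominated factor by factor by Euler's product for
`sinh (π‖z‖) / (π‖z‖)`. -/
theorem inv_GammaSeq_mul_GammaSeq {a : ℂ} (ha : 0 ≤ a.re) (z : ℂ) {n : ℕ} (hn : n ≠ 0) :
    (Complex.GammaSeq (1 + a + z) n * Complex.GammaSeq (1 + a - z) n)⁻¹ =
      (Complex.GammaSeq (1 + a) n ^ 2)⁻¹ *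
        ∏ j ∈ Finset.range (n + 1), (1 - z ^ 2 / (1 + a + j) ^ 2) := by
  have hn' : (n : ℂ) ≠ 0 := by exact_mod_cast hn
  have hf : ((n.factorial : ℕ) : ℂ) ≠ 0 := by exact_mod_cast n.factorial_ne_zero
  have hj : ∀ j : ℕ, (1 + a + j : ℂ) ≠ 0 := by
    intro j h
    have := congrArg Complex.re h
    simp at this
    have hj : (0 : ℝ) ≤ j := j.cast_nonneg
    linarith
  have hpow : (n : ℂ) ^ (1 + a + z) * (n : ℂ) ^ (1 + a - z) = ((n : ℂ) ^ (1 + a)) ^ 2 := by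
    rw [← Complex.cpow_add _ _ hn', sq, ← Complex.cpow_add _ _ hn']
    congr 1
    ring
  have hpow0 : (n : ℂ) ^ (1 + a) ≠ 0 := by simp [Complex.cpow_eq_zero_iff, hn']
  have hprod : ∏ j ∈ Finset.range (n + 1), (1 - z ^ 2 / (1 + a + j) ^ 2) =
      (∏ j ∈ Finset.range (n + 1), (1 + a + z + j)) *
        (∏ j ∈ Finset.range (n + 1), (1 + a - z + j)) /
          (∏ j ∈ Finset.range (n + 1), (1 + a + j)) ^ 2 := by
    rw [← Finset.prod_mul_distrib, ← Finset.prod_pow, ← Finset.prod_div_distrib]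
    refine Finset.prod_congr rfl fun j _ => ?_
    have := hj j
    field_simp
    ring
  have hP : ∏ j ∈ Finset.range (n + 1), (1 + a + j : ℂ) ≠ 0 :=
    Finset.prod_ne_zero_iff.mpr fun j _ => hj j
  rw [hprod]
  simp only [Complex.GammaSeq]
  rw [div_mul_div_comm, mul_mul_mul_comm, hpow, div_pow, inv_div, inv_div]
  field_simp

theorem norm_one_sub_sq_div_le {a : ℂ} (ha : 0 ≤ a.re) (z : ℂ) (j : ℕ) :
    ‖1 - z ^ 2 / (1 + a + j) ^ 2‖ ≤ 1 + ‖z‖ ^ 2 / ((j : ℝ) + 1) ^ 2 := by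
  refine (norm_sub_le _ _).trans ?_
  rw [norm_one, norm_div, norm_pow, norm_pow]
  have h : (j : ℝ) + 1 ≤ ‖1 + a + j‖ := by
    refine le_trans ?_ (Complex.re_le_norm _)
    simp
    linarith
  gcongr

theorem tendsto_prod_one_add_sq (r : ℝ) :
    Tendsto (fun n : ℕ => Real.pi * r * ∏ j ∈ Finset.range n, (1 + r ^ 2 / ((j : ℝ) + 1) ^ 2))
      atTop (𝓝 (Real.sinh (Real.pi * r))) := by
  have h := (Complex.tendsto_euler_sin_prod (r * Complex.I)).mul_const (-Complex.I)
  have h2 := (Complex.continuous_re.tendsto _).comp h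
  have h3 : (Complex.sin (Real.pi * (r * Complex.I)) * -Complex.I).re =
      Real.sinh (Real.pi * r) := by
    rw [← mul_assoc, Complex.sin_mul_I, mul_assoc]
    simp only [mul_neg, Complex.I_mul_I, neg_neg, mul_one]
    rw [← Complex.ofReal_mul, ← Complex.ofReal_sinh, Complex.ofReal_re]
  rw [h3] at h2
  refine h2.congr fun n => ?_
  have h4 : ∏ j ∈ Finset.range n, ((1 : ℂ) - (r * Complex.I) ^ 2 / ((j : ℂ) + 1) ^ 2) =
      ((∏ j ∈ Finset.range n, (1 + r ^ 2 / ((j : ℝ) + 1) ^ 2) : ℝ) : ℂ) := by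
    push_cast
    refine Finset.prod_congr rfl fun j _ => ?_
    rw [mul_pow, Complex.I_sq]
    ring
  simp only [Function.comp]
  rw [h4]
  have : ∀ x y : ℂ, x * (y * Complex.I) * (((∏ j ∈ Finset.range n,
      (1 + r ^ 2 / ((j : ℝ) + 1) ^ 2) : ℝ)) : ℂ) * -Complex.I = x * y * (((∏ j ∈ Finset.range n,
      (1 + r ^ 2 / ((j : ℝ) + 1) ^ 2) : ℝ)) : ℂ) := by
    intro x y
    linear_combination (-x * y * (((∏ j ∈ Finset.range n,
      (1 + r ^ 2 / ((j : ℝ) + 1) ^ 2) : ℝ)) : ℂ)) * Complex.I_sq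
  rw [this]
  norm_cast

theorem sinh_le_self_mul_exp {x : ℝ} : Real.sinh x ≤ x * Real.exp x := by
  have h1 := Real.add_one_le_exp (-2 * x)
  have h2 : Real.exp x * Real.exp (-2 * x) = Real.exp (-x) := by
    rw [← Real.exp_add]
    ring_nf
  rw [Real.sinh_eq]
  nlinarith [Real.exp_pos x]

theorem norm_evenRecipGamma_le_exp {a : ℂ} (ha : 0 ≤ a.re) (z : ℂ) :
    ‖evenRecipGamma a z‖ ≤ ‖(Complex.Gamma (1 + a) ^ 2)⁻¹‖ * Real.exp (Real.pi * ‖z‖) := by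
  -- At a pole the left side is `0` by the default values; elsewhere the limit of the approximants
  -- can be inverted.
  by_cases h0 : Complex.Gamma (1 + a + z) * Complex.Gamma (1 + a - z) = 0
  · rw [evenRecipGamma, h0]
    simp only [inv_zero, norm_zero]
    positivity
  rcases eq_or_ne z 0 with rfl | hz
  · simp [evenRecipGamma, sq]
  have hr : 0 < ‖z‖ := norm_pos_iff.mpr hz
  have hG : Complex.Gamma (1 + a) ^ 2 ≠ 0 :=
    pow_ne_zero _ (Complex.Gamma_ne_zero_of_re_pos (by simp; linarith))
  have h1 : Tendsto (fun n : ℕ => ‖(Complex.GammaSeq (1 + a + z) n *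
      Complex.GammaSeq (1 + a - z) n)⁻¹‖ * (Real.pi * ‖z‖)) atTop
      (𝓝 (‖evenRecipGamma a z‖ * (Real.pi * ‖z‖))) :=
    ((((Complex.GammaSeq_tendsto_Gamma _).mul (Complex.GammaSeq_tendsto_Gamma _)).inv₀
      h0).norm).mul_const _
  have h2 := (((Complex.GammaSeq_tendsto_Gamma (1 + a)).pow 2).inv₀ hG).norm.mul
    ((tendsto_prod_one_add_sq ‖z‖).comp (tendsto_add_atTop_nat 1))
  have h3 := le_of_tendsto_of_tendsto h1 h2 (by
    filter_upwards [eventually_ne_atTop 0] with n hn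
    rw [inv_GammaSeq_mul_GammaSeq ha z hn, norm_mul, norm_prod, mul_assoc]
    simp only [Function.comp, mul_comm (Real.pi * ‖z‖)]
    gcongr with j _
    exact norm_one_sub_sq_div_le ha z j)
  have h4 : ‖evenRecipGamma a z‖ * (Real.pi * ‖z‖) ≤
      ‖(Complex.Gamma (1 + a) ^ 2)⁻¹‖ * Real.exp (Real.pi * ‖z‖) * (Real.pi * ‖z‖) := by
    refine h3.trans ?_
    rw [mul_assoc]
    gcongr
    rw [mul_comm]
    exact (sinh_le_self_mul_exp).trans_eq (by ring)
  exact le_of_mul_le_mul_right h4 (by positivity)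

/-- An induction principle along `a ↦ a + 1`, starting in the right half plane. -/
theorem re_nonneg_induction {P : ℂ → Prop} (base : ∀ a : ℂ, 0 ≤ a.re → P a)
    (step : ∀ a, P (a + 1) → P a) (a : ℂ) : P a := by
  obtain ⟨n, hn⟩ := exists_nat_ge (-a.re)
  induction n generalizing a with
  | zero => exact base a (by simpa using hn)
  | succ n ih =>
    refine step a (ih (a + 1) ?_)
    push_cast at hn
    simp
    linarith

theorem sq_le_mul_exp {ε r : ℝ} (hε : 0 < ε) (hr : 0 ≤ r) :
    r ^ 2 ≤ (2 / ε) ^ 2 * Real.exp (ε * r) := by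
  have h1 : ε / 2 * r ≤ Real.exp (ε / 2 * r) := by
    linarith [Real.add_one_le_exp (ε / 2 * r)]
  have h2 : (ε / 2 * r) ^ 2 ≤ Real.exp (ε * r) := by
    calc (ε / 2 * r) ^ 2 ≤ Real.exp (ε / 2 * r) ^ 2 := by gcongr
      _ = Real.exp (ε * r) := by rw [← Real.exp_nat_mul]; push_cast; ring_nf
  calc r ^ 2 = (2 / ε) ^ 2 * (ε / 2 * r) ^ 2 := by field_simp
    _ ≤ _ := by gcongr

/-- Each shift of `a` costs a quadratic factor, absorbed by half of the spare `ε` in the exponent.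
-/
theorem exists_norm_evenRecipGamma_le_exp (a : ℂ) :
    ∀ ε > 0, ∃ C : ℝ, 0 ≤ C ∧ ∀ z, ‖evenRecipGamma a z‖ ≤ C * Real.exp ((Real.pi + ε) * ‖z‖) := by
  induction a using re_nonneg_induction with
  | base a ha =>
    intro ε hε
    refine ⟨‖(Complex.Gamma (1 + a) ^ 2)⁻¹‖, norm_nonneg _, fun z => (norm_evenRecipGamma_le_exp ha z).trans ?_⟩
    gcongr
    linarith
  | step a ih =>
    intro ε hε
    obtain ⟨C, hC, h⟩ := ih (ε / 2) (by positivity)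
    refine ⟨(‖1 + a‖ ^ 2 + (2 / (ε / 2)) ^ 2) * C, by positivity, fun z => ?_⟩
    rw [evenRecipGamma_eq_mul_add_one, norm_mul]
    have h1 : ‖(1 + a) ^ 2 - z ^ 2‖ ≤
        (‖1 + a‖ ^ 2 + (2 / (ε / 2)) ^ 2) * Real.exp (ε / 2 * ‖z‖) := by
      refine (norm_one_add_sq_sub_sq_le a z).trans ?_
      rw [add_mul]
      refine add_le_add (le_mul_of_one_le_right (by positivity) ?_)
        (sq_le_mul_exp (by positivity) (norm_nonneg z))
      exact Real.one_le_exp (by positivity)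
    refine (mul_le_mul h1 (h z) (norm_nonneg _) (by positivity)).trans_eq ?_
    rw [mul_mul_mul_comm, ← Real.exp_add]
    ring_nf

/-! ### Decay of a single factor on the real line. -/

theorem norm_sin_le_exp_abs_im (w : ℂ) : ‖Complex.sin w‖ ≤ Real.exp |w.im| := by
  rw [Complex.sin, norm_div, norm_mul, Complex.norm_I, mul_one, Complex.norm_ofNat,
    div_le_iff₀ two_pos]
  refine (norm_sub_le _ _).trans ?_
  rw [Complex.norm_exp, Complex.norm_exp]
  have h1 : (-w * Complex.I).re = w.im := by simp
  have h2 : (w * Complex.I).re = -w.im := by simp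
  rw [h1, h2]
  have h3 := Real.exp_le_exp.mpr (le_abs_self w.im)
  have h4 := Real.exp_le_exp.mpr (neg_le_abs w.im)
  linarith

theorem norm_betaIntegral_le {u v : ℂ} (hu : 0 < u.re) (hv : 0 < v.re) :
    ‖Complex.betaIntegral u v‖ ≤
      Real.Gamma u.re * Real.Gamma v.re / Real.Gamma (u.re + v.re) := by
  have h1 : Complex.betaIntegral (u.re : ℂ) (v.re : ℂ) =
      ((∫ t : ℝ in 0..1, ‖(t : ℂ) ^ (u - 1) * (1 - (t : ℂ)) ^ (v - 1)‖ : ℝ) : ℂ) := by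
    rw [Complex.betaIntegral, ← intervalIntegral.integral_ofReal]
    refine intervalIntegral.integral_congr_Ioo_of_le zero_le_one fun t ht => ?_
    have h1t : 0 < 1 - t := by linarith [ht.2]
    rw [norm_mul, Complex.norm_cpow_eq_rpow_re_of_pos ht.1, ← Complex.ofReal_one,
      ← Complex.ofReal_sub 1 t, Complex.norm_cpow_eq_rpow_re_of_pos h1t, Complex.ofReal_mul,
      Complex.ofReal_cpow ht.1.le, Complex.ofReal_cpow h1t.le]
    simp
  have h2 := Complex.betaIntegral_eq_Gamma_mul_div (u.re : ℂ) (v.re : ℂ) (by simpa) (by simpa)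
  rw [h1, ← Complex.ofReal_add, Complex.Gamma_ofReal, Complex.Gamma_ofReal,
    Complex.Gamma_ofReal] at h2
  have h3 : (∫ t : ℝ in 0..1, ‖(t : ℂ) ^ (u - 1) * (1 - (t : ℂ)) ^ (v - 1)‖) =
      Real.Gamma u.re * Real.Gamma v.re / Real.Gamma (u.re + v.re) := by exact_mod_cast h2
  rw [← h3]
  exact intervalIntegral.norm_integral_le_integral_norm zero_le_one

/-- `log Γ` is convex and has slope `log (u - 1)` over `[u - 1, u]`, hence at least that slope over
`[u, u + v]`. -/
theorem Gamma_div_Gamma_add_le {u v : ℝ} (hu : 1 < u) (hv : 0 < v) :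
    Real.Gamma u / Real.Gamma (u + v) ≤ (u - 1) ^ (-v) := by
  have hu1 : 0 < u - 1 := by linarith
  have h := Real.convexOn_log_Gamma.slope_mono_adjacent (x := u - 1) (y := u) (z := u + v)
    hu1 (show 0 < u + v by linarith) (by linarith) (by linarith)
  have hG : Real.Gamma u = (u - 1) * Real.Gamma (u - 1) := by
    simpa using Real.Gamma_add_one hu1.ne'
  have p0 := Real.Gamma_pos_of_pos hu1
  have p1 := Real.Gamma_pos_of_pos (show 0 < u by linarith)
  have p2 := Real.Gamma_pos_of_pos (show 0 < u + v by linarith)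
  have h2 : Real.log (Real.Gamma u) = Real.log (u - 1) + Real.log (Real.Gamma (u - 1)) := by
    rw [hG, Real.log_mul hu1.ne' p0.ne']
  simp only [Function.comp, sub_sub_cancel, div_one, add_sub_cancel_left] at h
  rw [le_div_iff₀ hv] at h
  rw [← Real.log_le_log_iff (by positivity) (by positivity), Real.log_div p1.ne' p2.ne',
    Real.log_rpow hu1]
  nlinarith

theorem inv_Gamma_one_sub {w : ℂ} (hw : 0 < w.re) :
    (Complex.Gamma (1 - w))⁻¹ = Complex.Gamma w * (Complex.sin (Real.pi * w) / Real.pi) := by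
  have h := Complex.Gamma_mul_Gamma_one_sub w
  have h0 := Complex.Gamma_ne_zero_of_re_pos hw
  have hpi : (Real.pi : ℂ) ≠ 0 := by exact_mod_cast Real.pi_ne_zero
  rw [← inv_div (Real.pi : ℂ), ← h]
  field_simp

/-- Reflection turns `1 / Γ(1 + a - x)` into `Γ(x - a)` times a sine that is bounded for real `x`.
The remaining quotient `Γ(x - a) / Γ(x + a + 1)` is a Beta integral over `Γ(2a + 1)`, and that
integral is bounded by its value at the real parts of its arguments. -/
theorem norm_evenRecipGamma_le_of_large {a : ℂ} (ha : 0 ≤ a.re) {x : ℝ} (hx : a.re + 2 ≤ x) :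
    ‖evenRecipGamma a x‖ ≤
      Real.exp (Real.pi * |a.im|) / Real.pi * ‖(Complex.Gamma (2 * a + 1))⁻¹‖ *
        Real.Gamma (2 * a.re + 1) * (x - a.re - 1) ^ (-(2 * a.re + 1)) := by
  have hu : 0 < (x - a : ℂ).re := by simp; linarith
  have hv : 0 < (2 * a + 1 : ℂ).re := by simp; linarith
  have hbeta := Complex.Gamma_mul_Gamma_eq_betaIntegral hu hv
  rw [show x - a + (2 * a + 1) = 1 + a + x by ring] at hbeta
  have hv0 := Complex.Gamma_ne_zero_of_re_pos hv
  have hs0 : Complex.Gamma (1 + a + x) ≠ 0 :=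
    Complex.Gamma_ne_zero_of_re_pos (by simp; linarith)
  have hq : Complex.Gamma (x - a) * (Complex.Gamma (1 + a + x))⁻¹ =
      (Complex.Gamma (2 * a + 1))⁻¹ * Complex.betaIntegral (x - a) (2 * a + 1) := by
    rw [← div_eq_mul_inv, div_eq_iff hs0, mul_assoc, eq_inv_mul_iff_mul_eq₀ hv0]
    linear_combination hbeta
  have hsplit : evenRecipGamma a x =
      Complex.sin (Real.pi * (x - a)) / Real.pi * (Complex.Gamma (2 * a + 1))⁻¹ *
        Complex.betaIntegral (x - a) (2 * a + 1) := by
    rw [evenRecipGamma, mul_inv, show 1 + a - x = 1 - (x - a) by ring, inv_Gamma_one_sub hu,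
      mul_assoc, ← hq]
    ring
  have hsin : ‖Complex.sin (Real.pi * (x - a))‖ ≤ Real.exp (Real.pi * |a.im|) := by
    refine (norm_sin_le_exp_abs_im _).trans_eq ?_
    simp [abs_mul, abs_of_pos Real.pi_pos]
  have hB := norm_betaIntegral_le hu hv
  have e1 : (x - a : ℂ).re = x - a.re := by simp
  have e2 : (2 * a + 1 : ℂ).re = 2 * a.re + 1 := by simp
  rw [e1, e2] at hB
  have hG := Gamma_div_Gamma_add_le (u := x - a.re) (v := 2 * a.re + 1) (by linarith) (by linarith)
  have hGv : 0 < Real.Gamma (2 * a.re + 1) := Real.Gamma_pos_of_pos (by linarith)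
  have hB' : ‖Complex.betaIntegral (x - a) (2 * a + 1)‖ ≤
      Real.Gamma (2 * a.re + 1) * (x - a.re - 1) ^ (-(2 * a.re + 1)) := by
    refine hB.trans ?_
    rw [mul_comm, mul_div_assoc]
    gcongr
  rw [hsplit, norm_mul, norm_mul, norm_div, Complex.norm_real, Real.norm_of_nonneg Real.pi_pos.le,
    mul_assoc _ (Real.Gamma (2 * a.re + 1))]
  gcongr

theorem exists_norm_evenRecipGamma_ofReal_le (a : ℂ) :
    ∃ C : ℝ, 0 ≤ C ∧ ∀ x : ℝ,
      ‖evenRecipGamma a x‖ ≤ C * (1 + |x|) ^ (-(2 * a.re + 1)) := by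
  induction a using re_nonneg_induction with
  | base a ha =>
    set s : ℝ := 2 * a.re + 1 with hs
    have hcont : Continuous fun x : ℝ => ‖evenRecipGamma a x‖ * (1 + |x|) ^ s := by
      refine ((differentiable_evenRecipGamma a).continuous.comp
        Complex.continuous_ofReal).norm.mul (Continuous.rpow_const (by fun_prop) fun x => ?_)
      left
      positivity
    obtain ⟨C₁, hC₁⟩ := (isCompact_Icc (a := 0) (b := a.re + 2)).bddAbove_image hcont.continuousOn
    set K : ℝ := Real.exp (Real.pi * |a.im|) / Real.pi * ‖(Complex.Gamma (2 * a + 1))⁻¹‖ *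
        Real.Gamma (2 * a.re + 1) with hK
    have hK0 : 0 ≤ K := by
      have : 0 < Real.Gamma (2 * a.re + 1) := Real.Gamma_pos_of_pos (by linarith)
      positivity
    have hpos : ∀ x : ℝ, 0 ≤ x →
        ‖evenRecipGamma a x‖ ≤ max C₁ (K * (a.re + 3) ^ s) * (1 + |x|) ^ (-s) := by
      intro x hx
      have hx1 : 0 < 1 + |x| := by positivity
      rcases le_total x (a.re + 2) with h | h
      · have h1 : ‖evenRecipGamma a x‖ * (1 + |x|) ^ s ≤ C₁ := hC₁ ⟨x, ⟨hx, h⟩, rfl⟩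
        calc ‖evenRecipGamma a x‖ = ‖evenRecipGamma a x‖ * (1 + |x|) ^ s * (1 + |x|) ^ (-s) := by
              rw [mul_assoc, ← Real.rpow_add hx1]
              simp
          _ ≤ _ := by
              gcongr
              exact h1.trans (le_max_left _ _)
      · have h1 := norm_evenRecipGamma_le_of_large ha h
        have h3 : (0 : ℝ) < a.re + 3 := by linarith
        -- `a.re + 3` is the largest value of `(1 + x) / (x - a.re - 1)` on `x ≥ a.re + 2`, taken at
        -- the left end.
        have h2 : (x - a.re - 1) ^ (-s) ≤ (a.re + 3) ^ s * (1 + |x|) ^ (-s) := by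
          have : (a.re + 3) ^ s * (1 + |x|) ^ (-s) = ((1 + |x|) / (a.re + 3)) ^ (-s) := by
            rw [Real.div_rpow hx1.le h3.le, Real.rpow_neg h3.le, div_inv_eq_mul, mul_comm]
          rw [this]
          refine Real.rpow_le_rpow_of_nonpos (by positivity) ?_ (by linarith)
          rw [div_le_iff₀ h3, abs_of_nonneg hx]
          nlinarith
        calc ‖evenRecipGamma a x‖ ≤ K * (x - a.re - 1) ^ (-s) := h1
          _ ≤ K * ((a.re + 3) ^ s * (1 + |x|) ^ (-s)) := by gcongr
          _ = K * (a.re + 3) ^ s * (1 + |x|) ^ (-s) := by ring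
          _ ≤ _ := by
            gcongr
            exact le_max_right _ _
    refine ⟨max C₁ (K * (a.re + 3) ^ s), ?_, fun x => ?_⟩
    · exact le_max_of_le_right (mul_nonneg hK0 (Real.rpow_nonneg (by linarith) _))
    · rcases le_total 0 x with h | h
      · exact hpos x h
      · have := hpos (-x) (by linarith)
        rwa [Complex.ofReal_neg, evenRecipGamma_neg, abs_neg] at this
  | step a ih =>
    obtain ⟨C, hC, h⟩ := ih
    refine ⟨(‖1 + a‖ ^ 2 + 1) * C, by positivity, fun x => ?_⟩
    have hx1 : 0 < 1 + |x| := by positivity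
    have h1 : ‖(1 + a) ^ 2 - (x : ℂ) ^ 2‖ ≤ (‖1 + a‖ ^ 2 + 1) * (1 + |x|) ^ (2 : ℝ) := by
      refine (norm_one_add_sq_sub_sq_le a x).trans ?_
      rw [Complex.norm_real, Real.norm_eq_abs, Real.rpow_two]
      have := abs_nonneg x
      nlinarith [sq_nonneg ‖1 + a‖, mul_nonneg (sq_nonneg ‖1 + a‖) this,
        mul_nonneg (sq_nonneg ‖1 + a‖) (sq_nonneg |x|)]
    rw [evenRecipGamma_eq_mul_add_one, norm_mul]
    refine (mul_le_mul h1 (h x) (norm_nonneg _) (by positivity)).trans_eq ?_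
    rw [mul_mul_mul_comm, ← Real.rpow_add hx1]
    congr 2
    simp
    ring

/-! ### Paley–Wiener: exponential type bounds the support of the Fourier transform. -/

section PaleyWiener

open Complex FourierTransform

variable {f : ℂ → ℂ} {A B c c' : ℝ}

/-- Phragmén–Lindelöf in a half plane. The weight `z + I` has no zero in the upper half plane and
records the decay of `f`, which later makes the vertical sides of a contour negligible. -/
theorem exists_norm_mul_norm_add_I_le_exp_im (hf : Differentiable ℂ f) (hc : 0 ≤ c) (hcc' : c < c')
    (hexp : ∀ z, ‖f z‖ ≤ A * Real.exp (c * ‖z‖)) (hreal : ∀ x : ℝ, ‖f x‖ * (1 + |x|) ≤ B)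
    {z : ℂ} (hz : 0 ≤ z.im) : ‖f z‖ * ‖z + I‖ ≤ B * Real.exp (c' * z.im) := by
  -- The rotation `z = I * w` takes the right half plane to the upper one. On the positive axis the
  -- gap `c' - c` absorbs the linear weight; on the imaginary axis the exponential has norm `1` and
  -- `hreal` gives the bound `B`.
  set F : ℂ → ℂ := fun w => f (I * w) * (I * w + I) * Complex.exp (-c' * w) with hF
  have hA : 0 ≤ A := by simpa using (norm_nonneg _).trans (hexp 0)
  have hnorm : ∀ w, ‖F w‖ = ‖f (I * w)‖ * ‖I * w + I‖ * Real.exp (-c' * w.re) := by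
    intro w
    rw [hF, norm_mul, norm_mul, Complex.norm_exp]
    simp
  have hle : ∀ w, ‖F w‖ ≤ A * Real.exp (c * ‖w‖) * (‖w‖ + 1) * Real.exp (-c' * w.re) := by
    intro w
    rw [hnorm]
    have h1 : ‖f (I * w)‖ ≤ A * Real.exp (c * ‖w‖) := by simpa using hexp (I * w)
    have h2 : ‖I * w + I‖ ≤ ‖w‖ + 1 := by simpa using norm_add_le (I * w) I
    gcongr
  have hd : Differentiable ℂ F := by
    refine ((hf.comp (f := fun w : ℂ => I * w) (by fun_prop)).mul (by fun_prop)).mul ?_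
    fun_prop
  have key : ‖F (-I * z)‖ ≤ B := by
    refine PhragmenLindelof.right_half_plane_of_bounded_on_real hd.diffContOnCl
      ⟨1, by norm_num, c + 1, ?_⟩ ?_ (fun x => ?_) (by simpa using hz)
    · refine Asymptotics.IsBigO.of_bound A ?_
      refine eventually_inf_principal.mpr (Eventually.of_forall fun w hw => (hle w).trans ?_)
      have hw : 0 < w.re := hw
      have h1 : Real.exp (-c' * w.re) ≤ 1 := by
        rw [Real.exp_le_one_iff]
        nlinarith
      rw [Real.rpow_one, Real.norm_eq_abs, Real.abs_exp, add_mul, Real.exp_add, one_mul]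
      calc A * Real.exp (c * ‖w‖) * (‖w‖ + 1) * Real.exp (-c' * w.re)
          ≤ A * Real.exp (c * ‖w‖) * Real.exp ‖w‖ * 1 := by
            gcongr
            exact Real.add_one_le_exp _
        _ = _ := by ring
    · have hδ : 0 < c' - c := by linarith
      refine isBoundedUnder_of_eventually_le (a := A * ((c' - c)⁻¹ + 1)) ?_
      filter_upwards [eventually_ge_atTop 0] with x hx
      refine (hle x).trans ?_
      rw [Complex.norm_real, Real.norm_of_nonneg hx, Complex.ofReal_re]
      have h1 : x + 1 ≤ ((c' - c)⁻¹ + 1) * Real.exp ((c' - c) * x) := by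
        have h2 : (c' - c)⁻¹ * ((c' - c) * x) ≤ (c' - c)⁻¹ * Real.exp ((c' - c) * x) := by
          gcongr
          linarith [Real.add_one_le_exp ((c' - c) * x)]
        rw [inv_mul_cancel_left₀ hδ.ne'] at h2
        have h3 : 1 ≤ Real.exp ((c' - c) * x) := Real.one_le_exp (by positivity)
        linarith
      calc A * Real.exp (c * x) * (x + 1) * Real.exp (-c' * x)
          ≤ A * Real.exp (c * x) * (((c' - c)⁻¹ + 1) * Real.exp ((c' - c) * x)) *
              Real.exp (-c' * x) := by gcongr
        _ = A * ((c' - c)⁻¹ + 1) * (Real.exp (c * x) * Real.exp ((c' - c) * x) *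
              Real.exp (-c' * x)) := by ring
        _ = A * ((c' - c)⁻¹ + 1) := by
          rw [← Real.exp_add, ← Real.exp_add,
            show c * x + (c' - c) * x + -c' * x = 0 by ring, Real.exp_zero, mul_one]
    · rw [hnorm]
      have h1 : I * (x * I) = ((-x : ℝ) : ℂ) := by
        push_cast
        linear_combination (x : ℂ) * I_mul_I
      rw [h1]
      refine le_trans ?_ (hreal (-x))
      have h2 : ‖((-x : ℝ) : ℂ) + I‖ ≤ 1 + |-x| := by
        refine (norm_add_le _ _).trans_eq ?_
        rw [Complex.norm_real, Complex.norm_I, Real.norm_eq_abs, add_comm]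
      have h3 : Real.exp (-c' * (x * I : ℂ).re) = 1 := by simp
      rw [h3, mul_one]
      gcongr
  rw [hnorm, show I * (-I * z) = z by linear_combination -z * I_mul_I] at key
  have h1 : (-I * z).re = z.im := by simp
  rw [h1] at key
  calc ‖f z‖ * ‖z + I‖ = ‖f z‖ * ‖z + I‖ * Real.exp (-c' * z.im) * Real.exp (c' * z.im) := by
        rw [mul_assoc _ (Real.exp _), ← Real.exp_add]
        simp
    _ ≤ _ := by gcongr

/-- For such `ξ` the kernel decays in the upper half plane faster than `f` can grow, so the contour
can be pushed up to infinity. -/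
theorem fourier_eq_zero_of_exponential_type (hf : Differentiable ℂ f) (hc : 0 ≤ c)
    (hexp : ∀ z, ‖f z‖ ≤ A * Real.exp (c * ‖z‖)) (hreal : ∀ x : ℝ, ‖f x‖ * (1 + |x|) ≤ B)
    (hint : MeasureTheory.Integrable fun x : ℝ => f x) {ξ : ℝ} (hξ : c < -(2 * Real.pi * ξ)) :
    𝓕 (fun x : ℝ => f x) ξ = 0 := by
  obtain ⟨c', hcc', hc'⟩ := exists_between hξ
  set δ : ℝ := -(2 * Real.pi * ξ) - c' with hδ
  have hδ0 : 0 < δ := by linarith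
  have hB : 0 ≤ B := le_trans (by positivity) (hreal 0)
  set G : ℂ → ℂ := fun z => Complex.exp (-2 * Real.pi * z * ξ * I) * f z with hG
  have hGd : Differentiable ℂ G := by
    refine Differentiable.mul ?_ hf
    fun_prop
  have hGle : ∀ z : ℂ, 0 ≤ z.im → ‖G z‖ * ‖z + I‖ ≤ B * Real.exp (-δ * z.im) := by
    intro z hz
    have h1 := exists_norm_mul_norm_add_I_le_exp_im hf hc hcc' hexp hreal hz
    have h2 : (-2 * Real.pi * z * ξ * I).re = 2 * Real.pi * ξ * z.im := by
      simp
      ring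
    rw [hG, norm_mul, Complex.norm_exp, h2, mul_assoc]
    calc _ ≤ Real.exp (2 * Real.pi * ξ * z.im) * (B * Real.exp (c' * z.im)) := by gcongr
      _ = B * (Real.exp (2 * Real.pi * ξ * z.im) * Real.exp (c' * z.im)) := by ring
      _ = _ := by
        rw [← Real.exp_add, hδ]
        ring_nf
  have hGint : MeasureTheory.Integrable fun x : ℝ => G x := by
    refine hint.bdd_mul (c := 1) (by fun_prop) (Eventually.of_forall fun x => ?_)
    rw [Complex.norm_exp]
    simp
  have hfour : 𝓕 (fun x : ℝ => f x) ξ = ∫ x : ℝ, G x := by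
    rw [Real.fourier_real_eq_integral_exp_smul]
    simp [hG]
  -- The rectangle has half-width `T ^ 2` and height `T`: each vertical side contributes at most `T
  -- * B / T ^ 2`, and the top at most `2 * T ^ 2 * B * exp (-δ * T)`.
  have hsq : Tendsto (fun T : ℝ => T ^ 2) atTop atTop := tendsto_pow_atTop two_ne_zero
  have hlim := MeasureTheory.intervalIntegral_tendsto_integral hGint
    (tendsto_neg_atTop_atBot.comp hsq) hsq
  have hzero : Tendsto (fun T : ℝ => ∫ x : ℝ in -(T ^ 2)..T ^ 2, G x) atTop (𝓝 0) := by
    have hb : Tendsto (fun T : ℝ => 2 * B * (T ^ (2 : ℝ) * Real.exp (-δ * T)) + 2 * B * T⁻¹)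
        atTop (𝓝 0) := by
      simpa using ((tendsto_rpow_mul_exp_neg_mul_atTop_nhds_zero 2 δ hδ0).const_mul (2 * B)).add
        (tendsto_inv_atTop_zero.const_mul (2 * B))
    refine squeeze_zero_norm' ?_ hb
    filter_upwards [eventually_gt_atTop 0] with T hT
    have hrect := Complex.integral_boundary_rect_eq_zero_of_differentiableOn G
      ((-(T ^ 2) : ℝ) : ℂ) ((T ^ 2 : ℝ) + (T : ℝ) * I) hGd.differentiableOn
    have r1 : (((-(T ^ 2) : ℝ) : ℂ)).re = -(T ^ 2) := Complex.ofReal_re _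
    have r2 : (((-(T ^ 2) : ℝ) : ℂ)).im = 0 := Complex.ofReal_im _
    have r3 : (((T ^ 2 : ℝ) : ℂ) + (T : ℝ) * I).re = T ^ 2 := by
      rw [Complex.add_re, Complex.ofReal_re]
      simp
    have r4 : (((T ^ 2 : ℝ) : ℂ) + (T : ℝ) * I).im = T := by
      rw [Complex.add_im, Complex.ofReal_im]
      simp
    rw [r1, r2, r3, r4] at hrect
    simp only [Complex.ofReal_zero, zero_mul, add_zero] at hrect
    have htop : ‖∫ x : ℝ in -(T ^ 2)..T ^ 2, G (x + T * I)‖ ≤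
        B * Real.exp (-δ * T) * |T ^ 2 - -(T ^ 2)| := by
      refine intervalIntegral.norm_integral_le_of_norm_le_const fun x _ => ?_
      have h := hGle (x + T * I) (by simpa using hT.le)
      have him : (x + T * I : ℂ).im = T := by simp
      rw [him] at h
      refine le_trans (le_mul_of_one_le_right (norm_nonneg _) ?_) h
      refine le_trans ?_ (Complex.abs_im_le_norm _)
      rw [Complex.add_im, him, Complex.I_im]
      exact le_trans (by linarith) (le_abs_self _)
    have hside : ∀ s : ℝ, |s| = T ^ 2 →
        ‖∫ y : ℝ in (0 : ℝ)..T, G ((s : ℝ) + y * I)‖ ≤ B / T ^ 2 * |T - 0| := by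
      intro s hs
      refine intervalIntegral.norm_integral_le_of_norm_le_const fun y hy => ?_
      rw [Set.uIoc_of_le hT.le] at hy
      have h := hGle (s + y * I) (by simpa using hy.1.le)
      have him : (s + y * I : ℂ).im = y := by simp
      rw [him] at h
      have h1 : T ^ 2 ≤ ‖(s + y * I : ℂ) + I‖ := by
        refine le_trans ?_ (Complex.abs_re_le_norm _)
        simp [hs]
      have h2 : Real.exp (-δ * y) ≤ 1 := by
        rw [Real.exp_le_one_iff]
        nlinarith [hy.1]
      rw [le_div_iff₀ (by positivity)]
      calc _ ≤ ‖G (s + y * I)‖ * ‖(s + y * I : ℂ) + I‖ := by gcongr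
        _ ≤ B * Real.exp (-δ * y) := h
        _ ≤ B := mul_le_of_le_one_right hB h2
    have hs1 := hside (T ^ 2) (abs_of_nonneg (by positivity))
    have hs2 := hside (-(T ^ 2)) (by rw [abs_neg, abs_of_nonneg (by positivity)])
    have hsolve : (∫ x : ℝ in -(T ^ 2)..T ^ 2, G x) =
        (∫ x : ℝ in -(T ^ 2)..T ^ 2, G (x + T * I)) -
          I * (∫ y : ℝ in (0 : ℝ)..T, G ((T ^ 2 : ℝ) + y * I)) +
          I * (∫ y : ℝ in (0 : ℝ)..T, G ((-(T ^ 2) : ℝ) + y * I)) := by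
      simp only [smul_eq_mul] at hrect
      linear_combination hrect
    rw [hsolve]
    refine (norm_add_le _ _).trans ((add_le_add_left (norm_sub_le _ _) _).trans ?_)
    rw [norm_mul, norm_mul, Complex.norm_I, one_mul, one_mul]
    have e1 : |T ^ 2 - -(T ^ 2)| = 2 * T ^ 2 := by
      rw [abs_of_nonneg (by nlinarith)]
      ring
    have e2 : B / T ^ 2 * |T - 0| = B * T⁻¹ := by
      rw [sub_zero, abs_of_pos hT]
      field_simp
    rw [e1] at htop
    rw [e2] at hs1 hs2
    rw [Real.rpow_two]
    linarith
  rw [hfour]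
  exact tendsto_nhds_unique hlim hzero

end PaleyWiener

/-! ### Integer shifts of `1/Γ` and bilateral terms. -/

theorem inv_Gamma_eq_ascPochhammer_mul (s : ℂ) (n : ℕ) :
    (Complex.Gamma s)⁻¹ = (ascPochhammer ℂ n).eval s * (Complex.Gamma (s + n))⁻¹ := by
  induction n with
  | zero => simp
  | succ n ih =>
    rw [ih, ascPochhammer_succ_eval,
      Complex.one_div_Gamma_eq_self_mul_one_div_Gamma_add_one (s + n)]
    push_cast
    rw [add_assoc]
    ring

theorem ascPochhammer_eval_one_sub_sub (c : ℂ) (n : ℕ) :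
    (ascPochhammer ℂ n).eval (1 - c - n) = (-1) ^ n * (ascPochhammer ℂ n).eval c := by
  have h := ascPochhammer_eval_neg_eq_descPochhammer ℂ (c + n - 1) n
  rw [descPochhammer_eval_eq_ascPochhammer] at h
  rwa [show -(c + n - 1) = 1 - c - n by ring, show c + n - 1 - n + 1 = c by ring] at h

/-- Reciprocals keep the identity valid when `c + n` is a pole: the shifted factorial is then the
inverse of `0`, and both sides are `0`. -/
theorem inv_Gamma_add_intCast {c : ℂ} (hc : ∀ n : ℕ, c ≠ -(n : ℂ)) (n : ℤ) :
    (Complex.Gamma (c + n))⁻¹ = (Complex.Gamma c)⁻¹ * (shiftedFactorial c n)⁻¹ := by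
  cases n with
  | ofNat n =>
    have h0 : (ascPochhammer ℂ n).eval c ≠ 0 := by
      rw [Ne, ascPochhammer_eval_eq_zero_iff]
      rintro ⟨k, -, hk⟩
      exact hc k (by rw [hk, neg_neg])
    simp only [shiftedFactorial, Int.ofNat_eq_natCast, Int.cast_natCast]
    rw [inv_Gamma_eq_ascPochhammer_mul c n]
    field_simp
  | negSucc n =>
    simp only [shiftedFactorial, inv_inv]
    rw [inv_Gamma_eq_ascPochhammer_mul _ (n + 1)]
    push_cast [Int.cast_negSucc]
    rw [show c + -((n : ℂ) + 1) + (n + 1) = c by ring, mul_comm, ← sub_eq_add_neg]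

theorem inv_Gamma_one_sub_sub_intCast {c : ℂ} (hc : ∀ n : ℕ, c ≠ (n : ℂ) + 1) (n : ℤ) :
    (Complex.Gamma (1 - c - n))⁻¹ =
      (-1) ^ n * ((Complex.Gamma (1 - c))⁻¹ * shiftedFactorial c n) := by
  cases n with
  | ofNat n =>
    simp only [shiftedFactorial, Int.ofNat_eq_natCast, Int.cast_natCast, zpow_natCast]
    rw [inv_Gamma_eq_ascPochhammer_mul _ n, ascPochhammer_eval_one_sub_sub, sub_add_cancel]
    ring
  | negSucc n =>
    have h0 : (ascPochhammer ℂ (n + 1)).eval (c - (n + 1)) ≠ 0 := by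
      rw [Ne, ascPochhammer_eval_eq_zero_iff]
      rintro ⟨k, hk, hk'⟩
      refine hc (n - k) ?_
      rw [Nat.cast_sub (by omega), hk']
      ring
    have h1 := inv_Gamma_eq_ascPochhammer_mul (1 - c) (n + 1)
    have h2 := ascPochhammer_eval_one_sub_sub (c - (n + 1)) (n + 1)
    push_cast at h1 h2
    rw [show 1 - (c - ((n : ℂ) + 1)) - (n + 1) = 1 - c by ring] at h2
    have h3 : ((-1 : ℂ) ^ (n + 1)) * (-1) ^ (n + 1) = 1 := by
      rw [← mul_pow]
      simp
    simp only [shiftedFactorial]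
    rw [h1, h2, zpow_negSucc]
    push_cast [Int.cast_negSucc]
    rw [show 1 - c - -((n : ℂ) + 1) = 1 - c + (n + 1) by ring]
    have h4 : (-1 : ℂ) ^ (n + 1) ≠ 0 := by simp
    field_simp

theorem inv_Gamma_mul_Gamma_add_intCast {a s : ℂ} (h1 : ∀ n : ℕ, a + 1 + s ≠ -(n : ℂ))
    (h2 : ∀ n : ℕ, -a + s ≠ (n : ℂ) + 1) (n : ℤ) :
    (Complex.Gamma (1 + a + (n + s)) * Complex.Gamma (1 + a - (n + s)))⁻¹ =
      (-1) ^ n * ((Complex.Gamma (a + 1 + s) * Complex.Gamma (a + 1 - s))⁻¹ *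
        (shiftedFactorial (-a + s) n / shiftedFactorial (a + 1 + s) n)) := by
  have e1 := inv_Gamma_add_intCast h1 n
  have e2 := inv_Gamma_one_sub_sub_intCast h2 n
  rw [show 1 - (-a + s) - n = 1 + a - (n + s) by ring, show 1 - (-a + s) = a + 1 - s by ring] at e2
  rw [show a + 1 + s + n = 1 + a + (n + s) by ring] at e1
  rw [mul_inv, e1, e2]
  ring

theorem recipGammaProd_eq_bilateralTerm {a : Fin 6 → ℂ} {s : ℂ}
    (h1 : ∀ j, ∀ n : ℕ, a j + 1 + s ≠ -(n : ℂ)) (h2 : ∀ j, ∀ n : ℕ, -a j + s ≠ (n : ℂ) + 1)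
    (n : ℤ) :
    recipGammaProd a a (n + s) =
      (1 / ∏ j, (Complex.Gamma (a j + 1 + s) * Complex.Gamma (a j + 1 - s))) *
        bilateralTerm (fun j => -a j + s) (fun j => a j + 1 + s) 1 n := by
  simp only [recipGammaProd, bilateralTerm, one_zpow, mul_one, one_div]
  rw [← Finset.prod_inv_distrib, ← Finset.prod_inv_distrib, ← Finset.prod_div_distrib,
    ← Finset.prod_mul_distrib]
  rw [Finset.prod_congr rfl fun j _ => inv_Gamma_mul_Gamma_add_intCast (h1 j) (h2 j) n,
    Finset.prod_mul_distrib]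
  -- The reflection signs cancel because the number of factors is even; hence the argument `1`.
  have h6 : ∏ _j : Fin 6, (-1 : ℂ) ^ n = 1 := by
    rw [Finset.prod_const, Finset.card_univ, Fintype.card_fin, ← zpow_natCast, ← zpow_mul]
    exact Even.neg_one_zpow (by simp [Int.even_mul]; right; decide)
  rw [h6, one_mul]

/-! ### The full product: type, decay and support of its Fourier transform. -/

section

variable {m : ℕ}

theorem recipGammaProd_self (a : Fin m → ℂ) (z : ℂ) :
    recipGammaProd a a z = ∏ j, evenRecipGamma (a j) z := by
  simp only [recipGammaProd, evenRecipGamma, one_div, Finset.prod_inv_distrib]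

theorem differentiable_recipGammaProd_self (a : Fin m → ℂ) :
    Differentiable ℂ (recipGammaProd a a) := by
  rw [funext (recipGammaProd_self a)]
  exact Differentiable.fun_finsetProd fun j _ => differentiable_evenRecipGamma (a j)

theorem recipGammaProd_self_neg (a : Fin m → ℂ) (z : ℂ) :
    recipGammaProd a a (-z) = recipGammaProd a a z := by
  simp only [recipGammaProd_self, evenRecipGamma_neg]

theorem exists_norm_recipGammaProd_self_le_exp (a : Fin m → ℂ) {ε : ℝ} (hε : 0 < ε) :
    ∃ C : ℝ, ∀ z, ‖recipGammaProd a a z‖ ≤ C * Real.exp (m * (Real.pi + ε) * ‖z‖) := by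
  choose C _ hC using fun j => exists_norm_evenRecipGamma_le_exp (a j) ε hε
  refine ⟨∏ j, C j, fun z => ?_⟩
  rw [recipGammaProd_self, norm_prod]
  refine (Finset.prod_le_prod (fun j _ => norm_nonneg _) fun j _ => hC j z).trans_eq ?_
  rw [Finset.prod_mul_distrib, Finset.prod_const, Finset.card_univ, Fintype.card_fin,
    ← Real.exp_nat_mul, mul_assoc]

theorem exists_norm_recipGammaProd_self_ofReal_le (a : Fin m → ℂ) :
    ∃ C : ℝ, 0 ≤ C ∧ ∀ x : ℝ,
      ‖recipGammaProd a a x‖ ≤ C * (1 + |x|) ^ (-(2 * (∑ j, a j).re + m)) := by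
  choose C hC0 hC using fun j => exists_norm_evenRecipGamma_ofReal_le (a j)
  refine ⟨∏ j, C j, Finset.prod_nonneg fun j _ => hC0 j, fun x => ?_⟩
  rw [recipGammaProd_self, norm_prod]
  refine (Finset.prod_le_prod (fun j _ => norm_nonneg _) fun j _ => hC j x).trans_eq ?_
  rw [Finset.prod_mul_distrib, ← Real.rpow_sum_of_pos (by positivity)]
  simp [Finset.sum_add_distrib, Finset.mul_sum]

theorem continuous_recipGammaProd_self_ofReal (a : Fin m → ℂ) :
    Continuous fun x : ℝ => recipGammaProd a a x :=
  (differentiable_recipGammaProd_self a).continuous.comp Complex.continuous_ofReal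

theorem integrable_recipGammaProd_self {a : Fin m → ℂ} (ha : 1 < 2 * (∑ j, a j).re + m) :
    MeasureTheory.Integrable fun x : ℝ => recipGammaProd a a x := by
  obtain ⟨C, hC0, hC⟩ := exists_norm_recipGammaProd_self_ofReal_le a
  refine ((integrable_one_add_norm (E := ℝ) (μ := MeasureTheory.volume)
    (r := 2 * (∑ j, a j).re + m) (by simpa using ha)).const_mul C).mono'
    (continuous_recipGammaProd_self_ofReal a).aestronglyMeasurable (Eventually.of_forall hC)

theorem isBigO_recipGammaProd_self {a : Fin m → ℂ} (ha : 1 < 2 * (∑ j, a j).re + m) :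
    (fun x : ℝ => recipGammaProd a a x) =O[cocompact ℝ]
      fun x : ℝ => |x| ^ (-(2 * (∑ j, a j).re + m)) := by
  obtain ⟨C, hC0, hC⟩ := exists_norm_recipGammaProd_self_ofReal_le a
  refine Asymptotics.IsBigO.of_bound C ?_
  have h0 : ∀ᶠ x : ℝ in cocompact ℝ, x ≠ 0 :=
    (isCompact_singleton (x := (0 : ℝ))).compl_mem_cocompact
  filter_upwards [h0] with x hx
  refine (hC x).trans ?_
  rw [Real.norm_of_nonneg (by positivity)]
  gcongr C * ?_
  exact Real.rpow_le_rpow_of_nonpos (abs_pos.mpr hx) (by linarith) (by linarith)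

theorem summable_recipGammaProd_self {a : Fin m → ℂ} (ha : 1 < 2 * (∑ j, a j).re + m) (s : ℝ) :
    Summable fun n : ℤ => recipGammaProd a a ((n + s : ℝ) : ℂ) := by
  have ht : Tendsto (fun n : ℤ => (n + s : ℝ)) cofinite (cocompact ℝ) :=
    (Homeomorph.addRight s).isClosedEmbedding.tendsto_cocompact.comp Int.tendsto_coe_cofinite
  refine summable_of_isBigO ?_ ((isBigO_recipGammaProd_self ha).comp_tendsto ht)
  refine ((Real.summable_one_div_int_add_rpow s _).mpr ha).congr fun n => ?_
  simp only [Function.comp]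
  rw [Real.rpow_neg (abs_nonneg _), one_div]

open FourierTransform in
theorem fourier_recipGammaProd_self_neg (a : Fin m → ℂ) (ξ : ℝ) :
    𝓕 (fun x : ℝ => recipGammaProd a a x) (-ξ) = 𝓕 (fun x : ℝ => recipGammaProd a a x) ξ := by
  rw [← Real.fourierInv_eq_fourier_neg, Real.fourierInv_eq_fourier_comp_neg]
  simp only [Complex.ofReal_neg, recipGammaProd_self_neg]

open FourierTransform in
theorem fourier_recipGammaProd_self_eq_zero {a : Fin m → ℂ} (ha : 1 < 2 * (∑ j, a j).re + m)
    {ξ : ℝ} (hξ : (m : ℝ) / 2 ≤ |ξ|) : 𝓕 (fun x : ℝ => recipGammaProd a a x) ξ = 0 := by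
  have hint := integrable_recipGammaProd_self ha
  have hcont : Continuous (𝓕 fun x : ℝ => recipGammaProd a a x) :=
    VectorFourier.fourierIntegral_continuous Real.continuous_fourierChar
      (innerSL ℝ).continuous₂ hint
  have hneg : ∀ ξ < -((m : ℝ) / 2), 𝓕 (fun x : ℝ => recipGammaProd a a x) ξ = 0 := by
    intro ξ hξ
    obtain ⟨C, hC0, hC⟩ := exists_norm_recipGammaProd_self_ofReal_le a
    obtain ⟨η, hη, hη'⟩ : ∃ η > 0, m * (Real.pi + η) < -(2 * Real.pi * ξ) := by
      -- The available gap is `2π(-ξ - m/2)`; this `η` makes `m * η` at most half of it, and `m + 1`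
      -- avoids division by zero.
      refine ⟨Real.pi * (-ξ - m / 2) / (m + 1), ?_, ?_⟩
      · have : 0 < -ξ - m / 2 := by linarith
        have := Real.pi_pos
        positivity
      · have h1 : 0 < Real.pi * (-ξ - m / 2) := mul_pos Real.pi_pos (by linarith)
        have h2 : m * (Real.pi * (-ξ - m / 2) / (m + 1)) ≤ Real.pi * (-ξ - m / 2) := by
          rw [mul_div_assoc', div_le_iff₀ (by positivity)]
          nlinarith
        nlinarith
    obtain ⟨A, hA⟩ := exists_norm_recipGammaProd_self_le_exp a hη
    have hpi := Real.pi_pos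
    refine fourier_eq_zero_of_exponential_type (differentiable_recipGammaProd_self a)
      (by positivity) hA (B := C) (fun x => ?_) hint hη'
    have h1 : 1 ≤ 1 + |x| := by linarith [abs_nonneg x]
    calc _ ≤ C * (1 + |x|) ^ (-(2 * (∑ j, a j).re + m)) * (1 + |x|) := by
          gcongr
          exact hC x
      _ ≤ C * (1 + |x|) ^ (-1 : ℝ) * (1 + |x|) := by
          gcongr
      _ = C := by
          rw [Real.rpow_neg_one]
          field_simp
  -- Continuity adds the endpoint, which matters: for `m = 6` it is the integer frequency `-3`.
  have hneg' : ∀ ξ ≤ -((m : ℝ) / 2), 𝓕 (fun x : ℝ => recipGammaProd a a x) ξ = 0 := by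
    intro ξ hξ
    have h := closure_minimal (s := Set.Iio (-((m : ℝ) / 2))) hneg
      (isClosed_eq hcont continuous_const)
    rw [closure_Iio] at h
    exact h hξ
  rcases le_total 0 ξ with h | h
  · rw [abs_of_nonneg h] at hξ
    rw [← fourier_recipGammaProd_self_neg]
    exact hneg' _ (by linarith)
  · rw [abs_of_nonpos h] at hξ
    exact hneg' _ (by linarith)

end

/-! ### Poisson summation and the evaluation of the integral. -/

theorem sTerm_zero_eq {m : ℕ} (a : Fin m → ℂ) (p : ℕ) (k l : ℤ) :
    sTerm a a p k 0 l = recipGammaProd a a ((l : ℂ) + (k : ℂ) / (p : ℂ)) := by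
  simp [sTerm]

theorem summable_sTerm_zero {m : ℕ} {a : Fin m → ℂ} (ha : 1 < 2 * (∑ j, a j).re + m) (p : ℕ)
    (k : ℤ) : Summable (sTerm a a p k 0) := by
  refine (summable_recipGammaProd_self ha ((k : ℝ) / (p : ℝ))).congr fun l => ?_
  rw [sTerm_zero_eq]
  push_cast
  rfl

open FourierTransform in
theorem six_mul_sSum_eq {a : Fin 6 → ℂ} (ha : 1 < 2 * (∑ j, a j).re + (6 : ℕ)) (k : ℤ) :
    6 * sSum a a 6 k 0 = 𝓕 (fun x : ℝ => recipGammaProd a a x) 0 +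
      2 * Real.cos (Real.pi * k / 3) * 𝓕 (fun x : ℝ => recipGammaProd a a x) 1 +
      2 * Real.cos (2 * Real.pi * k / 3) * 𝓕 (fun x : ℝ => recipGammaProd a a x) 2 := by
  set f : ℝ → ℂ := fun x : ℝ => recipGammaProd a a x with hf
  have hvanish : ∀ ξ : ℝ, 3 ≤ |ξ| → 𝓕 f ξ = 0 := fun ξ hξ =>
    fourier_recipGammaProd_self_eq_zero ha (by norm_num; exact hξ)
  -- The transform vanishes outside a compact set, so it meets any decay rate that Poisson summation
  -- asks for.
  have hFO : 𝓕 f =O[cocompact ℝ] fun x : ℝ => |x| ^ (-(2 * (∑ j, a j).re + (6 : ℕ))) := by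
    refine (Asymptotics.isBigO_zero _ _).congr' ?_ EventuallyEq.rfl
    filter_upwards [(isCompact_Icc (a := (-3 : ℝ)) (b := 3)).compl_mem_cocompact] with x hx
    refine (hvanish x ?_).symm
    by_contra h
    exact hx (abs_le.mp (not_le.mp h).le)
  have hP := Real.tsum_eq_tsum_fourier_of_rpow_decay (continuous_recipGammaProd_self_ofReal a) ha
    (isBigO_recipGammaProd_self ha) hFO ((k : ℝ) / 6)
  have hS : 6 * sSum a a 6 k 0 = ∑' n : ℤ, f ((k : ℝ) / 6 + n) := by
    rw [sSum, ← mul_assoc]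
    norm_num
    refine tsum_congr fun l => ?_
    rw [sTerm_zero_eq, hf]
    push_cast
    rw [add_comm]
  have hexp : ∀ n : ℤ, fourier n (((k : ℝ) / 6 : ℝ) : UnitAddCircle) =
      Complex.exp (n * (Real.pi * k / 3) * Complex.I) := by
    intro n
    rw [fourier_coe_apply]
    push_cast
    congr 1
    ring
  rw [hS, hP, tsum_eq_sum (s := ({-2, -1, 0, 1, 2} : Finset ℤ))]
  · have hcos : ∀ z : ℂ, 2 * Complex.cos z = Complex.exp (z * Complex.I) +
        Complex.exp (-z * Complex.I) := fun z => by
      rw [Complex.cos]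
      ring
    have h1 := fourier_recipGammaProd_self_neg a 1
    have h2 := fourier_recipGammaProd_self_neg a 2
    push_cast
    rw [hcos, hcos]
    simp only [hexp]
    rw [Finset.sum_insert (by decide), Finset.sum_insert (by decide),
      Finset.sum_insert (by decide), Finset.sum_insert (by decide), Finset.sum_singleton]
    push_cast
    rw [h1, h2, ← hf]
    simp only [zero_mul, Complex.exp_zero, one_mul]
    rw [show (2 : ℂ) * Real.pi * k / 3 = 2 * (Real.pi * k / 3) by ring]
    simp only [neg_mul, one_mul]
    ring
  · intro n hn
    rw [hvanish n, zero_mul]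
    have : 3 ≤ |n| := by
      by_contra h
      rw [not_le, abs_lt] at h
      apply hn
      simp only [Finset.mem_insert, Finset.mem_singleton]
      omega
    exact_mod_cast this

theorem cos_two_pi_div_three : Real.cos (2 * Real.pi / 3) = -(1 / 2) := by
  rw [show 2 * Real.pi / 3 = Real.pi - Real.pi / 3 by ring, Real.cos_pi_sub,
    Real.cos_pi_div_three]

theorem cos_four_pi_div_three : Real.cos (4 * Real.pi / 3) = -(1 / 2) := by
  rw [show 4 * Real.pi / 3 = Real.pi / 3 + Real.pi by ring, Real.cos_add_pi,
    Real.cos_pi_div_three]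

open FourierTransform in
theorem integral_recipGammaProd_self {m : ℕ} (a : Fin m → ℂ) :
    ∫ x : ℝ, recipGammaProd a a x = 𝓕 (fun x : ℝ => recipGammaProd a a x) 0 := by
  rw [Real.fourier_real_eq_integral_exp_smul]
  simp

/-- At `k = 0, 2` the cosine pairs are `(1, 1)` and `(-1/2, -1/2)`, so adding twice the second
relation to the first leaves `3 F(0)`. -/
theorem integral_recipGammaProd_self_eq_even {a : Fin 6 → ℂ}
    (ha : 1 < 2 * (∑ j, a j).re + (6 : ℕ)) :
    ∫ x : ℝ, recipGammaProd a a x = 2 * sSum a a 6 0 0 + 4 * sSum a a 6 2 0 := by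
  have h0 := six_mul_sSum_eq ha 0
  have h2 := six_mul_sSum_eq ha 2
  rw [show Real.pi * ((2 : ℤ) : ℝ) / 3 = 2 * Real.pi / 3 by push_cast; ring,
    show 2 * Real.pi * ((2 : ℤ) : ℝ) / 3 = 4 * Real.pi / 3 by push_cast; ring,
    cos_two_pi_div_three, cos_four_pi_div_three] at h2
  simp only [Int.cast_zero, mul_zero, zero_div, Real.cos_zero] at h0
  push_cast at h0 h2
  rw [integral_recipGammaProd_self]
  linear_combination (-1 / 3) * h0 - (2 / 3) * h2

/-- Here the pairs are `(-1, 1)` at `k = 3` and `(1/2, -1/2)` at `k = 1`, with the same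
cancellation. -/
theorem integral_recipGammaProd_self_eq_odd {a : Fin 6 → ℂ}
    (ha : 1 < 2 * (∑ j, a j).re + (6 : ℕ)) :
    ∫ x : ℝ, recipGammaProd a a x = 2 * sSum a a 6 3 0 + 4 * sSum a a 6 1 0 := by
  have h3 := six_mul_sSum_eq ha 3
  have h1 := six_mul_sSum_eq ha 1
  rw [show Real.pi * ((3 : ℤ) : ℝ) / 3 = Real.pi by push_cast; ring,
    show 2 * Real.pi * ((3 : ℤ) : ℝ) / 3 = 2 * Real.pi by push_cast; ring,
    Real.cos_pi, Real.cos_two_pi] at h3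
  rw [Int.cast_one, mul_one, mul_one, Real.cos_pi_div_three, cos_two_pi_div_three] at h1
  push_cast at h1 h3
  rw [integral_recipGammaProd_self]
  linear_combination (-1 / 3) * h3 - (2 / 3) * h1

theorem theorem5p7 (a : Fin 6 → ℂ) (ha : -5 / 2 < (∑ j, a j).re) :
    -- the integral converges absolutely, and so do the series that define the `S_k(0)`
    MeasureTheory.Integrable
      (fun x : ℝ => 1 / ∏ j, (Complex.Gamma (1 + a j + x) * Complex.Gamma (1 + a j - x))) ∧
    (∀ k : ℤ, Summable (sTerm a a 6 k 0)) ∧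
    -- the two evaluations
    (∫ x : ℝ, 1 / ∏ j, (Complex.Gamma (1 + a j + x) * Complex.Gamma (1 + a j - x))) =
      2 * sSum a a 6 0 0 + 4 * sSum a a 6 2 0 ∧
    (∫ x : ℝ, 1 / ∏ j, (Complex.Gamma (1 + a j + x) * Complex.Gamma (1 + a j - x))) =
      2 * sSum a a 6 3 0 + 4 * sSum a a 6 1 0 ∧
    -- `S_k(0)` as a hypergeometric series, whenever that series is well-defined
    (∀ k : ℤ,
      (∀ j, ∀ n : ℕ, a j + 1 + (k : ℂ) / 6 ≠ -(n : ℂ)) →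
      (∀ j, ∀ n : ℕ, -a j + (k : ℂ) / 6 ≠ (n : ℂ) + 1) →
      Summable (bilateralTerm (fun j => -a j + (k : ℂ) / 6) (fun j => a j + 1 + (k : ℂ) / 6) 1) ∧
      sSum a a 6 k 0 = 1 / 6 * cCoeff a a 6 k *
        bilateralH (fun j => -a j + (k : ℂ) / 6) (fun j => a j + 1 + (k : ℂ) / 6) 1) := by
  have hb : 1 < 2 * (∑ j, a j).re + (6 : ℕ) := by
    push_cast
    linarith
  refine ⟨integrable_recipGammaProd_self hb, summable_sTerm_zero hb 6,
    integral_recipGammaProd_self_eq_even hb, integral_recipGammaProd_self_eq_odd hb,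
    fun k h1 h2 => ?_⟩
  have hterm : ∀ l : ℤ, sTerm a a 6 k 0 l = cCoeff a a 6 k *
      bilateralTerm (fun j => -a j + (k : ℂ) / 6) (fun j => a j + 1 + (k : ℂ) / 6) 1 l := by
    intro l
    rw [sTerm_zero_eq, cCoeff]
    exact recipGammaProd_eq_bilateralTerm h1 h2 l
  -- Needed to divide by the prefactor and pass summability to the bilateral series; `h1` and `h2`
  -- say exactly that no Gamma factor is at a pole.
  have hC : cCoeff a a 6 k ≠ 0 := by
    rw [cCoeff]
    refine one_div_ne_zero (Finset.prod_ne_zero_iff.mpr fun j _ => mul_ne_zero ?_ ?_)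
    · exact Complex.Gamma_ne_zero (h1 j)
    · refine Complex.Gamma_ne_zero fun n hn => h2 j n ?_
      push_cast at hn
      linear_combination -hn
  refine ⟨?_, ?_⟩
  · rw [← summable_mul_left_iff hC]
    exact (summable_sTerm_zero hb 6 k).congr hterm
  · rw [sSum, tsum_congr hterm, tsum_mul_left, bilateralH, mul_assoc]
    push_cast
    rfl
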